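/- Let $T,\tau,q>0$ and let $\varphi_0\in L^1(0,T)$ be real-valued and not almost everywhere zero. For $\alpha\in\mathbb{R}^2$, with $|\alpha|$ the Euclidean norm, put $$D(\varphi_0,\tau)(\alpha)=\int_0^T\varphi_0(t)\,\sin(\sqrt{\tau}\,|\alpha|\,t)\,dt .$$ Then $D(\varphi_0,\tau)(\alpha)\neq 0$ for almost every $\alpha\in\mathbb{R}^2$. Moreover, for $\varepsilon>0$ small, put $$R_\varepsilon=\frac{q}{9eT}\cdot\frac{\ln(\varepsilon^{-1})}{\ln(\ln(\varepsilon^{-1}))},$$ where $e$ is the base of the natural logarithm. Then there is $\varepsilon_0>0$ (which may depend on $T,\tau,q,\varphi_0$) such that for all $\varepsilon\in(0,\varepsilon_0)$ the set $$B(\varphi_0,\tau,\varepsilon)=\{\alpha\in B(0,R_\varepsilon) : |D(\varphi_0,\tau)(\alpha)|\le\varepsilon^q\},$$ where $B(0,R_\varepsilon)$ is the open ball in $\mathbb{R}^2$ with centre $0$ and radius $R_\varepsilon$, has Lebesgue measure less than $R_\varepsilon^{-1}$. -/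

import Mathlib

noncomputable section

/-- `D(φ₀, τ)(α) = ∫₀ᵀ φ₀(t) sin(√τ |α| t) dt`, with `|α|` the Euclidean norm on `ℝ²`. -/
def sineD (T : ℝ) (φ₀ : ℝ → ℝ) (τ : ℝ) (α : EuclideanSpace ℝ (Fin 2)) : ℝ :=
  ∫ t in Set.Ioo 0 T, φ₀ t * Real.sin (Real.sqrt τ * ‖α‖ * t)

/-- `R_ε = q / (9 e T) · ln(ε⁻¹) / ln(ln(ε⁻¹))`, where `e = exp 1`. -/
def truncR (T q ε : ℝ) : ℝ :=
  q / (9 * Real.exp 1 * T) * (Real.log ε⁻¹ / Real.log (Real.log ε⁻¹))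

/-- The points `α` of the open ball `B(0, R_ε)` of `ℝ²` with `|D(φ₀, τ)(α)| ≤ ε ^ q`. -/
def smallSet (T : ℝ) (φ₀ : ℝ → ℝ) (τ q ε : ℝ) : Set (EuclideanSpace ℝ (Fin 2)) :=
  {α | α ∈ Metric.ball 0 (truncR T q ε) ∧ |sineD T φ₀ τ α| ≤ ε ^ q}

end

open MeasureTheory Filter Topology

/-! The value at `α` is `g(|α|)`, where `g` is a finite sine transform. It extends to an entire
function of exponential type `√τ T`, bounded on the real line and nonzero because the sine transform
is injective. Its zeros are therefore countable, and the zero set in the plane is a countable union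
of null circles.

For the measure bound, `ε ^ q ≤ exp (-c R log R)` with `R = R_ε` and `c = 9eT`. If `g` is that small
on a subset of `[0, R)` of measure above `R⁻³`, some interval of length `L = R / N` contains `n`, of
order `L`, such points, polynomially separated in `R`. The divided-difference remainder, with `n`-th
derivatives of geometric growth, then forces `|g| ≤ (C + 1) exp (-2L)` on the whole interval
(`abs_le_of_small_at_separated_points`). Jensen's inequality, carried to the upper half plane, makes
`log |g|` integrable against the Poisson weight, so far out `g` cannot be that small throughout such
an interval (`exists_exp_neg_le_norm`). This contradiction is `eventually_volume_sublevel_le`, valid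
for every `c > 0`. Polar coordinates turn `R⁻³` into a multiple of `R⁻²`, eventually below `R⁻¹`. -/

/-- The `n`-th derivative of the finite sine transform `x ↦ ∫₀ᵀ φ(t) sin(k x t) dt`. -/
noncomputable def sineDeriv (T : ℝ) (φ : ℝ → ℝ) (k : ℝ) (n : ℕ) (x : ℝ) : ℝ :=
  ∫ t in Set.Ioo 0 T, φ t * ((k * t) ^ n * Real.sin (k * x * t + n * (Real.pi / 2)))

/-- The finite sine transform, extended to an entire function. -/
noncomputable def sineEntire (T : ℝ) (φ : ℝ → ℝ) (k : ℝ) (z : ℂ) : ℂ :=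
  ∫ t in Set.Ioo 0 T, (φ t : ℂ) * Complex.sin (k * z * t)

theorem sineD_eq_sineDeriv (T : ℝ) (φ : ℝ → ℝ) (τ : ℝ) (α : EuclideanSpace ℝ (Fin 2)) :
    sineD T φ τ α = sineDeriv T φ (Real.sqrt τ) 0 ‖α‖ := by
  simp [sineD, sineDeriv]

/-! ### Derivatives and entire extension of the sine transform -/

section SineTransform

variable {T : ℝ} {φ : ℝ → ℝ} {k : ℝ}

theorem norm_sineDeriv_integrand_le (hk : 0 ≤ k) {t : ℝ} (ht : t ∈ Set.Ioo 0 T)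
    (n : ℕ) (y : ℝ) :
    ‖φ t * ((k * t) ^ n * Real.sin y)‖ ≤ |φ t| * (k * T) ^ n := by
  rw [norm_mul, norm_mul, norm_pow, Real.norm_eq_abs, Real.norm_eq_abs, Real.norm_eq_abs,
    abs_of_nonneg (mul_nonneg hk ht.1.le)]
  have h1 : (k * t) ^ n ≤ (k * T) ^ n :=
    pow_le_pow_left₀ (mul_nonneg hk ht.1.le) (mul_le_mul_of_nonneg_left ht.2.le hk) n
  have h2 := Real.abs_sin_le_one y
  have h3 : 0 ≤ (k * t) ^ n := pow_nonneg (mul_nonneg hk ht.1.le) n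
  refine mul_le_mul_of_nonneg_left ?_ (abs_nonneg _)
  nlinarith [abs_nonneg (Real.sin y)]

theorem abs_sineDeriv_le (hk : 0 ≤ k) (hφ : IntegrableOn φ (Set.Ioo 0 T)) (n : ℕ) (x : ℝ) :
    |sineDeriv T φ k n x| ≤ (∫ t in Set.Ioo 0 T, |φ t|) * (k * T) ^ n := by
  rw [← Real.norm_eq_abs, ← integral_mul_const]
  refine norm_integral_le_of_norm_le (hφ.abs.mul_const _) ?_
  filter_upwards [ae_restrict_mem measurableSet_Ioo] with t ht
  exact norm_sineDeriv_integrand_le hk ht n _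

/-- Differentiation under the integral: each derivative brings down `k t` and shifts the phase by `π
/ 2`, so one formula covers all orders. -/
theorem hasDerivAt_sineDeriv (hk : 0 ≤ k) (hφ : IntegrableOn φ (Set.Ioo 0 T)) (n : ℕ) (x : ℝ) :
    HasDerivAt (sineDeriv T φ k n) (sineDeriv T φ k (n + 1) x) x := by
  have hmeas : ∀ (m : ℕ) (y : ℝ), AEStronglyMeasurable
      (fun t => φ t * ((k * t) ^ m * Real.sin (k * y * t + m * (Real.pi / 2))))
      (volume.restrict (Set.Ioo 0 T)) := fun m y =>
    hφ.aestronglyMeasurable.mul (Continuous.aestronglyMeasurable (by fun_prop))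
  refine (hasDerivAt_integral_of_dominated_loc_of_deriv_le
    (F' := fun y t => φ t * ((k * t) ^ (n + 1) *
      Real.sin (k * y * t + (n + 1 : ℕ) * (Real.pi / 2))))
    (bound := fun t => |φ t| * (k * T) ^ (n + 1)) (univ_mem (f := 𝓝 x))
    (Eventually.of_forall fun y => hmeas n y) ?_ (hmeas (n + 1) x) ?_
    (hφ.abs.mul_const _) ?_).2
  · refine (hφ.abs.mul_const ((k * T) ^ n)).mono' (hmeas n x) ?_
    filter_upwards [ae_restrict_mem measurableSet_Ioo] with t ht
    exact norm_sineDeriv_integrand_le hk ht n _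
  · filter_upwards [ae_restrict_mem measurableSet_Ioo] with t ht y _
    exact norm_sineDeriv_integrand_le hk ht (n + 1) _
  · refine Eventually.of_forall fun t y _ => ?_
    have h1 : HasDerivAt (fun y : ℝ => k * y * t + n * (Real.pi / 2)) (k * t) y := by
      have := (((hasDerivAt_id y).const_mul k).mul_const t).add_const (n * (Real.pi / 2))
      simpa using this
    have h2 := (h1.sin.const_mul ((k * t) ^ n)).const_mul (φ t)
    refine h2.congr_deriv ?_
    rw [Nat.cast_add, Nat.cast_one, add_mul, one_mul, ← add_assoc, Real.sin_add_pi_div_two]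
    ring

theorem norm_complex_sin_le (z : ℂ) : ‖Complex.sin z‖ ≤ Real.exp |z.im| := by
  have h1 : ‖Complex.exp (-z * Complex.I)‖ ≤ Real.exp |z.im| := by
    rw [Complex.norm_exp]
    exact Real.exp_le_exp.2 (by simpa using le_abs_self z.im)
  have h2 : ‖Complex.exp (z * Complex.I)‖ ≤ Real.exp |z.im| := by
    rw [Complex.norm_exp]
    exact Real.exp_le_exp.2 (by simpa using neg_le_abs z.im)
  rw [Complex.sin, norm_div, norm_mul, Complex.norm_I, mul_one, Complex.norm_ofNat,
    div_le_iff₀ two_pos]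
  linarith [norm_sub_le (Complex.exp (-z * Complex.I)) (Complex.exp (z * Complex.I))]

theorem norm_complex_cos_le (z : ℂ) : ‖Complex.cos z‖ ≤ Real.exp |z.im| := by
  have := norm_complex_sin_le (z + Real.pi / 2)
  rw [Complex.sin_add_pi_div_two] at this
  have h : (z + Real.pi / 2 : ℂ).im = z.im := by
    rw [Complex.add_im]
    have : ((Real.pi : ℂ) / 2) = ((Real.pi / 2 : ℝ) : ℂ) := by push_cast; rfl
    rw [this, Complex.ofReal_im, add_zero]
  rwa [h] at this

theorem exp_abs_im_le (hk : 0 ≤ k) {t : ℝ} (ht : t ∈ Set.Ioo 0 T) (z : ℂ) :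
    Real.exp |((k : ℂ) * z * t).im| ≤ Real.exp (k * T * |z.im|) := by
  refine Real.exp_le_exp.2 ?_
  have : ((k : ℂ) * z * t).im = k * t * z.im := by simp; ring
  rw [this, abs_mul, abs_of_nonneg (mul_nonneg hk ht.1.le)]
  exact mul_le_mul_of_nonneg_right (mul_le_mul_of_nonneg_left ht.2.le hk) (abs_nonneg _)

theorem norm_sineEntire_le (hk : 0 ≤ k) (hφ : IntegrableOn φ (Set.Ioo 0 T)) (z : ℂ) :
    ‖sineEntire T φ k z‖ ≤ (∫ t in Set.Ioo 0 T, |φ t|) * Real.exp (k * T * |z.im|) := by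
  rw [← integral_mul_const]
  refine norm_integral_le_of_norm_le (hφ.abs.mul_const _) ?_
  filter_upwards [ae_restrict_mem measurableSet_Ioo] with t ht
  rw [norm_mul, Complex.norm_real, Real.norm_eq_abs]
  exact mul_le_mul_of_nonneg_left
    ((norm_complex_sin_le _).trans (exp_abs_im_le hk ht z)) (abs_nonneg _)

theorem sineEntire_ofReal (x : ℝ) :
    sineEntire T φ k x = (sineDeriv T φ k 0 x : ℂ) := by
  rw [sineEntire, sineDeriv, ← integral_complex_ofReal]
  congr 1
  ext t
  push_cast
  simp

theorem differentiable_sineEntire (hk : 0 ≤ k) (hφ : IntegrableOn φ (Set.Ioo 0 T)) :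
    Differentiable ℂ (sineEntire T φ k) := by
  intro z₀
  have hmeas : ∀ f : ℝ → ℂ, Continuous f → AEStronglyMeasurable
      (fun t => (φ t : ℂ) * f t) (volume.restrict (Set.Ioo 0 T)) := fun f hf =>
    hφ.ofReal.aestronglyMeasurable.mul hf.aestronglyMeasurable
  refine (hasDerivAt_integral_of_dominated_loc_of_deriv_le
    (F' := fun z t => (φ t : ℂ) * (Complex.cos (k * z * t) * (k * t)))
    (bound := fun t => |φ t| * (Real.exp (k * T * (|z₀.im| + 1)) * (k * T)))
    (Metric.ball_mem_nhds z₀ one_pos)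
    (Eventually.of_forall fun z => hmeas _ (by fun_prop)) ?_ (hmeas _ (by fun_prop)) ?_
    (hφ.abs.mul_const _) ?_).2.differentiableAt
  · refine (hφ.abs.mul_const (Real.exp (k * T * |z₀.im|))).mono' (hmeas _ (by fun_prop)) ?_
    filter_upwards [ae_restrict_mem measurableSet_Ioo] with t ht
    rw [norm_mul, Complex.norm_real, Real.norm_eq_abs]
    exact mul_le_mul_of_nonneg_left
      ((norm_complex_sin_le _).trans (exp_abs_im_le hk ht _)) (abs_nonneg _)
  · filter_upwards [ae_restrict_mem measurableSet_Ioo] with t ht z hz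
    have hkt : ‖(k * t : ℂ)‖ ≤ k * T := by
      rw [← Complex.ofReal_mul, Complex.norm_real, Real.norm_eq_abs,
        abs_of_nonneg (mul_nonneg hk ht.1.le)]
      exact mul_le_mul_of_nonneg_left ht.2.le hk
    have hz' : |z.im| ≤ |z₀.im| + 1 := by
      have h1 : |(z - z₀).im| ≤ 1 :=
        (Complex.abs_im_le_norm _).trans (by rw [← dist_eq_norm]; exact (Metric.mem_ball.1 hz).le)
      rw [Complex.sub_im] at h1
      linarith [abs_sub_abs_le_abs_sub z.im z₀.im]
    have hkT : 0 ≤ k * T := mul_nonneg hk (ht.1.trans ht.2).le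
    rw [norm_mul, norm_mul, Complex.norm_real, Real.norm_eq_abs]
    refine mul_le_mul_of_nonneg_left (mul_le_mul ?_ hkt (norm_nonneg _) (Real.exp_nonneg _))
      (abs_nonneg _)
    exact ((norm_complex_cos_le _).trans (exp_abs_im_le hk ht _)).trans
      (Real.exp_le_exp.2 (mul_le_mul_of_nonneg_left hz' hkT))
  · refine Eventually.of_forall fun t z _ => ?_
    have h1 : HasDerivAt (fun z : ℂ => k * z * t) (k * t) z := by
      simpa using ((hasDerivAt_id z).const_mul (k : ℂ)).mul_const (t : ℂ)
    exact h1.csin.const_mul _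

end SineTransform

/-! ### Divided differences and separated points -/

/-- Iterated Rolle theorem for a chain of derivatives `S 0, S 1, …`. -/
theorem exists_chain_eq_zero_of_strictMono (n : ℕ) (S : ℕ → ℝ → ℝ)
    (hS : ∀ i x, HasDerivAt (S i) (S (i + 1) x) x) (v : Fin (n + 1) → ℝ) (hv : StrictMono v)
    (h0 : ∀ i, S 0 (v i) = 0) : ∃ ξ, S n ξ = 0 := by
  induction n generalizing S with
  | zero => exact ⟨v 0, h0 0⟩
  | succ n ih =>
    have hex : ∀ i : Fin (n + 1), ∃ c ∈ Set.Ioo (v i.castSucc) (v i.succ), S 1 c = 0 := fun i =>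
      exists_hasDerivAt_eq_zero (hv i.castSucc_lt_succ)
        (fun x _ => (hS 0 x).continuousAt.continuousWithinAt) (by rw [h0, h0])
        (fun x _ => hS 0 x)
    choose c hc hc0 using hex
    have hcm : StrictMono c := by
      intro i j hij
      have h1 : v i.succ ≤ v j.castSucc := hv.monotone (by
        rw [Fin.le_def]; simpa using Nat.succ_le_of_lt hij)
      exact ((hc i).2.trans_le h1).trans (hc j).1
    exact ih (fun i => S (i + 1)) (fun i x => hS (i + 1) x) c hcm hc0

theorem exists_chain_eq_zero (n : ℕ) (S : ℕ → ℝ → ℝ)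
    (hS : ∀ i x, HasDerivAt (S i) (S (i + 1) x) x) (s : Finset ℝ) (hs : s.card = n + 1)
    (h0 : ∀ x ∈ s, S 0 x = 0) : ∃ ξ, S n ξ = 0 :=
  exists_chain_eq_zero_of_strictMono n S hS (s.orderEmbOfFin hs) (s.orderEmbOfFin hs).strictMono
    fun i => h0 _ (s.orderEmbOfFin_mem hs i)

/-- The mean value theorem for divided differences. -/
theorem exists_chain_eq_factorial_mul_dividedDifference (n : ℕ) (S : ℕ → ℝ → ℝ)
    (hS : ∀ i x, HasDerivAt (S i) (S (i + 1) x) x) (s : Finset ℝ) (hs : s.card = n + 1) :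
    ∃ ξ, S n ξ = n.factorial * ∑ x ∈ s, S 0 x / ∏ y ∈ s.erase x, (x - y) := by
  classical
  have hinj : Set.InjOn (id : ℝ → ℝ) s := Function.injective_id.injOn
  set Q := Lagrange.interpolate s id (S 0) with hQ
  have hdeg : Q.degree < s.card := Lagrange.degree_interpolate_lt _ hinj
  have heval : ∀ x ∈ s, Q.eval x = S 0 x := fun x hx =>
    Lagrange.eval_interpolate_at_node (S 0) hinj hx
  -- The interpolation error vanishes at all `n + 1` nodes, so Rolle applies; the `n`-th derivative
  -- of `Q` is constant, `n!` times the divided difference.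
  obtain ⟨ξ, hξ⟩ := exists_chain_eq_zero n
    (fun i x => S i x - (Polynomial.derivative^[i] Q).eval x)
    (fun i x => by
      have := (Polynomial.derivative^[i] Q).hasDerivAt x
      rw [← Function.iterate_succ_apply' Polynomial.derivative i Q] at this
      exact (hS i x).sub this) s hs
    (fun x hx => by simp [heval x hx])
  refine ⟨ξ, ?_⟩
  rw [sub_eq_zero.1 hξ, Lagrange.eval_iterate_derivative_eq_sum hinj hdeg (by omega)]
  congr 1
  refine Finset.sum_congr rfl fun x hx => ?_
  rw [hs, Nat.sub_self, Finset.powersetCard_zero]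
  simp [heval x hx]

/-- A function which is small at `n` separated points of an interval, and whose `n`-th derivative
is bounded, is small on the whole interval. -/
theorem abs_le_of_small_at_separated_points {n : ℕ} {S : ℕ → ℝ → ℝ}
    (hS : ∀ i x, HasDerivAt (S i) (S (i + 1) x) x) {D η L d : ℝ} (hD : ∀ x, |S n x| ≤ D)
    (hη : 0 ≤ η) (hd : 0 < d) (hdL : d ≤ L) {s : Finset ℝ} (hs : s.card = n) (hn : 0 < n)
    (hsmall : ∀ x ∈ s, |S 0 x| ≤ η) (hsep : ∀ x ∈ s, ∀ y ∈ s, x ≠ y → d ≤ |x - y|)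
    {x : ℝ} (hx : ∀ y ∈ s, |x - y| ≤ L) :
    |S 0 x| ≤ D * L ^ n / n.factorial + n * (η * (L / d) ^ n) := by
  classical
  have hL : 0 < L := hd.trans_le hdL
  have hD0 : 0 ≤ D := (abs_nonneg _).trans (hD 0)
  have hr1 : 1 ≤ L / d := (one_le_div hd).2 hdL
  by_cases hxs : x ∈ s
  · have h1 : (1 : ℝ) ≤ n := by exact_mod_cast hn
    have h2 : 1 ≤ (L / d) ^ n := one_le_pow₀ hr1
    have h3 : η ≤ n * (η * (L / d) ^ n) := by
      have : η * 1 ≤ η * (L / d) ^ n := mul_le_mul_of_nonneg_left h2 hη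
      nlinarith
    have h4 : 0 ≤ D * L ^ n / n.factorial := by positivity
    linarith [hsmall x hxs]
  obtain ⟨ξ, hξ⟩ := exists_chain_eq_factorial_mul_dividedDifference n S hS (insert x s)
    (by rw [Finset.card_insert_of_notMem hxs, hs])
  rw [Finset.sum_insert hxs, Finset.erase_insert hxs] at hξ
  set W := ∏ y ∈ s, (x - y) with hW
  have hW0 : W ≠ 0 := Finset.prod_ne_zero_iff.2 fun y hy => sub_ne_zero.2 fun h => hxs (h ▸ hy)
  have hWL : |W| ≤ L ^ n := by
    rw [hW, Finset.abs_prod, ← hs]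
    exact (Finset.prod_le_prod (fun _ _ => abs_nonneg _) hx).trans_eq (Finset.prod_const _)
  have hfac : (0 : ℝ) < n.factorial := by exact_mod_cast n.factorial_pos
  -- The divided-difference identity on the nodes `s ∪ {x}`, solved for the value at `x`.
  have key : S 0 x = W * (S n ξ / n.factorial) -
      ∑ z ∈ s, W * (S 0 z / ∏ y ∈ (insert x s).erase z, (z - y)) := by
    rw [hξ, ← Finset.mul_sum]
    field_simp
    ring
  have hterm : ∀ z ∈ s, |W * (S 0 z / ∏ y ∈ (insert x s).erase z, (z - y))|
      ≤ η * (L / d) ^ n := by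
    intro z hz
    have hzx : z ≠ x := fun h => hxs (h ▸ hz)
    have hxe : x ∉ s.erase z := fun h => hxs (Finset.mem_of_mem_erase h)
    rw [Finset.erase_insert_of_ne hzx.symm, Finset.prod_insert hxe, hW,
      ← Finset.mul_prod_erase s (fun y => x - y) hz]
    have hzx' : z - x ≠ 0 := sub_ne_zero.2 hzx
    have hP : ∏ y ∈ s.erase z, (z - y) ≠ 0 := Finset.prod_ne_zero_iff.2 fun y hy =>
      sub_ne_zero.2 (Finset.ne_of_mem_erase hy).symm
    -- The factor `x - z` cancels, leaving only ratios `(x - y) / (z - y)`, each at most `L / d`.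
    have hrw : (x - z) * (∏ y ∈ s.erase z, (x - y)) *
        (S 0 z / ((z - x) * ∏ y ∈ s.erase z, (z - y))) =
        -(S 0 z * ((∏ y ∈ s.erase z, (x - y)) / ∏ y ∈ s.erase z, (z - y))) := by
      field_simp
      ring
    rw [hrw, abs_neg, abs_mul, ← Finset.prod_div_distrib, Finset.abs_prod]
    refine mul_le_mul (hsmall z hz) ?_ (Finset.prod_nonneg fun _ _ => abs_nonneg _) hη
    calc ∏ y ∈ s.erase z, |(x - y) / (z - y)| ≤ (L / d) ^ (s.erase z).card := by
          refine (Finset.prod_le_prod (fun _ _ => abs_nonneg _) fun y hy => ?_).trans_eq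
            (Finset.prod_const _)
          rw [abs_div]
          exact div_le_div₀ hL.le (hx y (Finset.mem_of_mem_erase hy)) hd
            (hsep z hz y (Finset.mem_of_mem_erase hy) (Finset.ne_of_mem_erase hy).symm)
      _ ≤ (L / d) ^ n := pow_le_pow_right₀ hr1 (hs ▸ Finset.card_erase_le)
  rw [key]
  refine (abs_sub _ _).trans (add_le_add ?_ ?_)
  · rw [abs_mul, abs_div, abs_of_pos hfac, mul_div_assoc', mul_comm |W|]
    gcongr
    exact hD ξ
  · refine (Finset.abs_sum_le_sum_abs _ _).trans ((Finset.sum_le_sum hterm).trans ?_)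
    simp [hs]

/-- A subset of the line of large outer measure contains many separated points. -/
theorem exists_separated_finset {E : Set ℝ} {d : ℝ} (n : ℕ)
    (hE : ENNReal.ofReal (2 * n * d) < volume E) (hd : 0 < d) :
    ∃ s : Finset ℝ, s.card = n ∧ ↑s ⊆ E ∧ ∀ x ∈ s, ∀ y ∈ s, x ≠ y → d ≤ |x - y| := by
  classical
  induction n generalizing E with
  | zero => exact ⟨∅, by simp⟩
  | succ n ih =>
    obtain ⟨x, hx⟩ : E.Nonempty := nonempty_of_measure_ne_zero (zero_le.trans_lt hE).ne'
    have h1 : volume E ≤ volume (E \ Metric.ball x d) + ENNReal.ofReal (2 * d) := by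
      rw [← Real.volume_ball]
      have hsub : E ⊆ E \ Metric.ball x d ∪ Metric.ball x d := by simp
      exact (measure_mono hsub).trans (measure_union_le _ _)
    have h2 : ENNReal.ofReal (2 * n * d) < volume (E \ Metric.ball x d) := by
      have h3 : ENNReal.ofReal (2 * (n + 1 : ℕ) * d) =
          ENNReal.ofReal (2 * n * d) + ENNReal.ofReal (2 * d) := by
        rw [← ENNReal.ofReal_add (by positivity) (by positivity)]
        congr 1
        push_cast
        ring
      rw [h3] at hE
      exact lt_of_add_lt_add_right (hE.trans_le h1)
    obtain ⟨s, hs, hsE, hsep⟩ := ih h2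
    have hfar : ∀ y ∈ s, d ≤ |y - x| := fun y hy => by
      have := (hsE hy).2
      rwa [Metric.mem_ball, not_lt, Real.dist_eq] at this
    have hxs : x ∉ s := fun h => by
      have := hfar x h
      simp at this
      linarith
    refine ⟨insert x s, by rw [Finset.card_insert_of_notMem hxs, hs], ?_, ?_⟩
    · intro y hy
      rcases Finset.mem_insert.1 (Finset.mem_coe.1 hy) with rfl | hy
      · exact hx
      · exact (hsE hy).1
    · intro y hy z hz hyz
      rcases Finset.mem_insert.1 hy with hyx | hys <;> rcases Finset.mem_insert.1 hz with hzx | hzs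
      · exact absurd (hyx.trans hzx.symm) hyz
      · rw [hyx, abs_sub_comm]; exact hfar z hzs
      · rw [hzx]; exact hfar y hys
      · exact hsep y hys z hzs hyz

/-! ### Cayley transform and Jensen's inequality -/

/-- Conformal map of the unit disc onto the upper half plane, taking `0` to `i y`. -/
noncomputable def discToHalfPlane (y : ℝ) (w : ℂ) : ℂ := Complex.I * y * ((1 + w) / (1 - w))

theorem one_sub_ne_zero_of_norm_lt_one {w : ℂ} (hw : ‖w‖ < 1) : 1 - w ≠ 0 := fun h => by
  rw [← sub_eq_zero.1 h, norm_one] at hw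
  exact lt_irrefl _ hw

theorem discToHalfPlane_im_pos {y : ℝ} (hy : 0 < y) {w : ℂ} (hw : ‖w‖ < 1) :
    0 < (discToHalfPlane y w).im := by
  have h1 : 0 < Complex.normSq (1 - w) :=
    Complex.normSq_pos.2 (one_sub_ne_zero_of_norm_lt_one hw)
  have h2 : w.re * w.re + w.im * w.im < 1 := by
    rw [← Complex.normSq_apply, Complex.normSq_eq_norm_sq]
    nlinarith [norm_nonneg w]
  have h3 : (discToHalfPlane y w).im =
      y * ((1 - (w.re * w.re + w.im * w.im)) / Complex.normSq (1 - w)) := by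
    rw [discToHalfPlane]
    have h4 : (Complex.I * y * ((1 + w) / (1 - w))).im = y * ((1 + w) / (1 - w)).re := by simp
    rw [h4, Complex.div_re, ← add_div]
    congr 2
    simp
    ring
  rw [h3]
  exact mul_pos hy (div_pos (by linarith) h1)

theorem differentiableAt_discToHalfPlane (y : ℝ) {w : ℂ} (hw : 1 - w ≠ 0) :
    DifferentiableAt ℂ (discToHalfPlane y) w := by
  unfold discToHalfPlane
  fun_prop (disch := assumption)

/-- The angle `π + 2 arctan s` is the boundary parameter that the Cayley map sends to the real point
`y s`; `s → ∞` corresponds to the pole `w = 1`. -/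
theorem circleMap_pi_add_two_mul_arctan (s : ℝ) :
    circleMap 0 1 (Real.pi + 2 * Real.arctan s) =
      -((1 + Complex.I * s) / (1 - Complex.I * s)) := by
  have hs : (0 : ℝ) < 1 + s ^ 2 := by positivity
  have h0 : (1 - Complex.I * s : ℂ) ≠ 0 := fun h => by simpa using congrArg Complex.re h
  have hr : (Real.sqrt (1 + s ^ 2) : ℂ) ^ 2 = (1 + Complex.I * s) * (1 - Complex.I * s) := by
    rw [← Complex.ofReal_pow, Real.sq_sqrt hs.le]
    push_cast
    linear_combination ((s : ℂ) ^ 2) * Complex.I_sq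
  have hr0 : (Real.sqrt (1 + s ^ 2) : ℂ) ≠ 0 := by
    exact_mod_cast (Real.sqrt_pos.2 hs).ne'
  have h1 : Complex.exp (Real.arctan s * Complex.I) =
      (1 + Complex.I * s) / Real.sqrt (1 + s ^ 2) := by
    rw [Complex.exp_mul_I, ← Complex.ofReal_cos, ← Complex.ofReal_sin, Real.cos_arctan,
      Real.sin_arctan]
    push_cast
    field_simp
  have h2 : ((Real.pi + 2 * Real.arctan s : ℝ) : ℂ) * Complex.I =
      Real.pi * Complex.I + (Real.arctan s * Complex.I + Real.arctan s * Complex.I) := by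
    push_cast
    ring
  rw [circleMap_zero, h2, Complex.exp_add, Complex.exp_pi_mul_I, Complex.exp_add, h1,
    Complex.ofReal_one, one_mul, neg_one_mul, div_mul_div_comm, ← sq (Real.sqrt _ : ℂ), hr]
  congr 1
  have h0' : (1 + Complex.I * s : ℂ) ≠ 0 := fun h => by simpa using congrArg Complex.re h
  field_simp

theorem one_sub_circleMap_ne_zero (s : ℝ) :
    1 - circleMap 0 1 (Real.pi + 2 * Real.arctan s) ≠ 0 := by
  have h0 : (1 - Complex.I * s : ℂ) ≠ 0 := fun h => by simpa using congrArg Complex.re h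
  have h1 : 1 - -((1 + Complex.I * s) / (1 - Complex.I * s)) = 2 / (1 - Complex.I * s) := by
    field_simp
    ring
  rw [circleMap_pi_add_two_mul_arctan, h1]
  exact div_ne_zero two_ne_zero h0

theorem discToHalfPlane_circleMap (y s : ℝ) :
    discToHalfPlane y (circleMap 0 1 (Real.pi + 2 * Real.arctan s)) = y * s := by
  have h0 : (1 - Complex.I * s : ℂ) ≠ 0 := fun h => by simpa using congrArg Complex.re h
  have h1 := one_sub_circleMap_ne_zero s
  rw [circleMap_pi_add_two_mul_arctan] at h1 ⊢
  have h2 : 1 - -((1 + Complex.I * s) / (1 - Complex.I * s)) = 2 / (1 - Complex.I * s) := by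
    field_simp; ring
  have h3 : 1 + -((1 + Complex.I * s) / (1 - Complex.I * s)) =
      -2 * Complex.I * s / (1 - Complex.I * s) := by
    field_simp; ring
  rw [discToHalfPlane, h2, h3]
  field_simp
  linear_combination (-(y : ℂ) * s) * Complex.I_sq

/-- Jensen's inequality for analytic functions on the unit disc. -/
theorem log_norm_le_circleAverage {H : ℂ → ℂ} (hH : DifferentiableOn ℂ H (Metric.ball 0 1))
    (h0 : H 0 ≠ 0) {r : ℝ} (hr0 : 0 < r) (hr1 : r < 1) :
    CircleIntegrable (fun w => Real.log ‖H w‖) 0 r ∧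
      Real.log ‖H 0‖ ≤ Real.circleAverage (fun w => Real.log ‖H w‖) 0 r := by
  have han : AnalyticOnNhd ℂ H (Metric.closedBall 0 |r|) :=
    (hH.analyticOnNhd Metric.isOpen_ball).mono (by
      rw [abs_of_pos hr0]; exact Metric.closedBall_subset_ball hr1)
  refine ⟨MeromorphicOn.circleIntegrable_log_norm
    (han.meromorphicOn.mono_set Metric.sphere_subset_closedBall), ?_⟩
  rw [han.circleAverage_log_norm hr0.ne' h0, le_add_iff_nonneg_left]
  refine finsum_nonneg fun u => ?_
  by_cases hu : u ∈ Metric.closedBall (0 : ℂ) |r|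
  · refine mul_nonneg ?_ ?_
    · exact_mod_cast MeromorphicOn.AnalyticOnNhd.divisor_nonneg han u
    · rcases eq_or_ne u 0 with rfl | hu0
      · simp
      · rw [mem_closedBall_zero_iff, abs_of_pos hr0] at hu
        refine Real.log_nonneg ?_
        rw [zero_sub, norm_neg, ← div_eq_mul_inv, one_le_div (norm_pos_iff.2 hu0)]
        exact hu
  · rw [Function.locallyFinsuppWithin.apply_eq_zero_of_notMem _ hu]
    simp

/-- Jensen's inequality for functions bounded by `C ≥ 1`, as a bound of a lower integral. -/
theorem lintegral_log_sub_log_norm_le {H : ℂ → ℂ} (hH : DifferentiableOn ℂ H (Metric.ball 0 1))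
    (h0 : H 0 ≠ 0) {C : ℝ} (hC : 1 ≤ C) (hb : ∀ w, ‖w‖ < 1 → ‖H w‖ ≤ C) {r : ℝ} (hr0 : 0 < r)
    (hr1 : r < 1) :
    ∫⁻ θ in Set.Ioc 0 (2 * Real.pi),
      ENNReal.ofReal (Real.log C - Real.log ‖H (circleMap 0 r θ)‖) ≤
      ENNReal.ofReal (2 * Real.pi * (Real.log C - Real.log ‖H 0‖)) := by
  obtain ⟨hint, hle⟩ := log_norm_le_circleAverage hH h0 hr0 hr1
  have hint' : IntervalIntegrable (fun θ => Real.log ‖H (circleMap 0 r θ)‖) volume 0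
    (2 * Real.pi) := hint
  have hpi := Real.two_pi_pos
  have hi := (intervalIntegrable_const (c := Real.log C) (μ := volume) (a := 0)
    (b := 2 * Real.pi)).sub hint'
  rw [← ofReal_integral_eq_lintegral_ofReal
    ((intervalIntegrable_iff_integrableOn_Ioc_of_le hpi.le).1 hi)]
  · refine ENNReal.ofReal_le_ofReal ?_
    rw [← intervalIntegral.integral_of_le hpi.le,
      intervalIntegral.integral_sub intervalIntegrable_const hint',
      intervalIntegral.integral_const]
    rw [Real.circleAverage_def, smul_eq_mul, inv_mul_eq_div, le_div_iff₀ hpi] at hle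
    simp only [smul_eq_mul]
    linarith
  · refine Eventually.of_forall fun θ => sub_nonneg.2 ?_
    rcases eq_or_ne (H (circleMap 0 r θ)) 0 with h | h
    · rw [h, norm_zero, Real.log_zero]; exact Real.log_nonneg hC
    · exact Real.log_le_log (norm_pos_iff.2 h)
        (hb _ (by rw [norm_circleMap_zero, abs_of_pos hr0]; exact hr1))

/-! ### Entire functions of exponential type -/

section ExponentialType

variable {F : ℂ → ℂ} {C σ y : ℝ}

/-- A nonzero entire function of exponential type which is bounded on the real line has an
integrable logarithm there (in the angular variable of the Cayley transform). -/
theorem exists_lintegrable_log_majorant (hF : Differentiable ℂ F)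
    (hb : ∀ z, ‖F z‖ ≤ C * Real.exp (σ * |z.im|)) (hy : 0 < y) (hFy : F (Complex.I * y) ≠ 0) :
    ∃ Λ : ℝ → ENNReal, ∫⁻ θ in Set.Ioc 0 (2 * Real.pi), Λ θ ≠ ⊤ ∧
      ∀ s m : ℝ, ‖F ((y * s : ℝ) : ℂ)‖ < Real.exp (-m) →
        ENNReal.ofReal m ≤ Λ (Real.pi + 2 * Real.arctan s) := by
  -- The factor `exp (iσζ)` cancels the growth of `F` in the upper half plane and has modulus one on
  -- the real line.
  set H : ℂ → ℂ := fun w =>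
    F (discToHalfPlane y w) * Complex.exp (Complex.I * σ * discToHalfPlane y w) with hHdef
  have hnorm : ∀ w, ‖H w‖ =
      ‖F (discToHalfPlane y w)‖ * Real.exp (-(σ * (discToHalfPlane y w).im)) := fun w => by
    rw [hHdef]
    simp only [norm_mul, Complex.norm_exp]
    congr 2
    simp
  set D := max C 1 with hD
  have hHb : ∀ w, ‖w‖ < 1 → ‖H w‖ ≤ D := fun w hw => by
    have h1 := hb (discToHalfPlane y w)
    rw [abs_of_pos (discToHalfPlane_im_pos hy hw)] at h1
    rw [hnorm, Real.exp_neg, mul_inv_le_iff₀ (Real.exp_pos _)]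
    exact h1.trans (mul_le_mul_of_nonneg_right (le_max_left _ _) (Real.exp_nonneg _))
  have hHd : DifferentiableOn ℂ H (Metric.ball 0 1) := fun w hw => by
    have h1 := differentiableAt_discToHalfPlane y
      (one_sub_ne_zero_of_norm_lt_one (mem_ball_zero_iff.1 hw))
    exact (((hF _).comp w h1).mul (h1.const_mul _).cexp).differentiableWithinAt
  have hH0 : H 0 ≠ 0 := by
    simpa [hHdef, discToHalfPlane, Complex.exp_ne_zero] using hFy
  have hHm : Measurable H := by
    have h1 : Measurable (discToHalfPlane y) := by unfold discToHalfPlane; fun_prop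
    exact (hF.continuous.measurable.comp h1).mul
      (Complex.measurable_exp.comp (measurable_const.mul h1))
  set r : ℕ → ℝ := fun n => 1 - 1 / (n + 2) with hr
  have hrpos : ∀ n, 0 < r n := fun n => by
    have : 1 / ((n : ℝ) + 2) < 1 :=
      (div_lt_one (by positivity)).2 (by linarith [n.cast_nonneg (α := ℝ)])
    simp only [hr]; linarith
  have hrlt : ∀ n, r n < 1 := fun n => by
    have : 0 < 1 / ((n : ℝ) + 2) := by positivity
    simp only [hr]; linarith
  have hrt : Tendsto r atTop (𝓝 1) := by
    have h1 : Tendsto (fun n : ℕ => 1 / ((n : ℝ) + 2)) atTop (𝓝 0) :=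
      tendsto_const_nhds.div_atTop
        (tendsto_atTop_add_const_right _ _ tendsto_natCast_atTop_atTop)
    simpa [hr] using tendsto_const_nhds.sub h1
  set V : ℕ → ℝ → ENNReal := fun n θ =>
    ENNReal.ofReal (Real.log D - Real.log ‖H (circleMap 0 (r n) θ)‖) with hV
  have hVm : ∀ n, Measurable (V n) := fun n =>
    (measurable_const.sub (Real.measurable_log.comp
      (hHm.comp (continuous_circleMap 0 (r n)).measurable).norm)).ennreal_ofReal
  -- Fatou's lemma transfers the Jensen bound, uniform in the radius, to the boundary.
  refine ⟨fun θ => liminf (fun n => V n θ) atTop, ?_, ?_⟩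
  · refine ne_top_of_le_ne_top (b := ENNReal.ofReal
      (2 * Real.pi * (Real.log D - Real.log ‖H 0‖))) ENNReal.ofReal_ne_top
      ((lintegral_liminf_le hVm).trans (liminf_le_of_le (by isBoundedDefault) fun b hb' => ?_))
    obtain ⟨n, hn⟩ := hb'.exists
    exact hn.trans (lintegral_log_sub_log_norm_le hHd hH0 (le_max_right _ _) hHb (hrpos n)
      (hrlt n))
  · intro s m hsm
    set θ := Real.pi + 2 * Real.arctan s with hθ
    have hw : Tendsto (fun n => circleMap 0 (r n) θ) atTop (𝓝 (circleMap 0 1 θ)) := by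
      simp only [circleMap_zero]
      exact ((Complex.continuous_ofReal.tendsto _).comp hrt).mul_const _
    have hZ : Tendsto (fun n => discToHalfPlane y (circleMap 0 (r n) θ)) atTop
        (𝓝 ((y * s : ℝ) : ℂ)) := by
      rw [Complex.ofReal_mul, ← discToHalfPlane_circleMap y s]
      exact (differentiableAt_discToHalfPlane y
        (one_sub_circleMap_ne_zero s)).continuousAt.tendsto.comp hw
    have hin : ∀ n, ‖circleMap 0 (r n) θ‖ < 1 := fun n => by
      rw [norm_circleMap_zero, abs_of_pos (hrpos n)]; exact hrlt n
    have hlim : ∀ᶠ n in atTop, ‖F (discToHalfPlane y (circleMap 0 (r n) θ))‖ *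
        Real.exp (-(σ * (discToHalfPlane y (circleMap 0 (r n) θ)).im)) < Real.exp (-m) := by
      have h1 : Tendsto (fun n => ‖F (discToHalfPlane y (circleMap 0 (r n) θ))‖ *
          Real.exp (-(σ * (discToHalfPlane y (circleMap 0 (r n) θ)).im))) atTop
          (𝓝 (‖F ((y * s : ℝ) : ℂ)‖ * Real.exp (-(σ * ((y * s : ℝ) : ℂ).im)))) := by
        have hc : Continuous fun z : ℂ => ‖F z‖ * Real.exp (-(σ * z.im)) := by
          have := hF.continuous
          fun_prop
        exact (hc.tendsto _).comp hZ
      rw [Complex.ofReal_im, mul_zero, neg_zero, Real.exp_zero, mul_one] at h1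
      exact h1.eventually_lt_const hsm
    -- Since `Real.log 0 = 0`, zeros on the radial path must be excluded. They are isolated, and the
    -- path stays strictly above its real endpoint.
    have hne : ∀ᶠ n in atTop, F (discToHalfPlane y (circleMap 0 (r n) θ)) ≠ 0 := by
      have han : AnalyticOnNhd ℂ F Set.univ :=
        hF.differentiableOn.analyticOnNhd isOpen_univ
      rcases (han ((y * s : ℝ) : ℂ) trivial).eventually_eq_zero_or_eventually_ne_zero with h | h
      · exact absurd (han.eqOn_zero_of_preconnected_of_eventuallyEq_zero
          isPreconnected_univ trivial h (Set.mem_univ (Complex.I * y))) hFy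
      · refine (tendsto_nhdsWithin_iff.2 ⟨hZ, Eventually.of_forall fun n => ?_⟩).eventually h
        intro hn
        have h1 := discToHalfPlane_im_pos hy (hin n)
        rw [Set.mem_singleton_iff.1 hn, Complex.ofReal_im] at h1
        exact lt_irrefl _ h1
    refine le_liminf_of_le (by isBoundedDefault) ?_
    filter_upwards [hlim, hne] with n h1 h2
    refine ENNReal.ofReal_le_ofReal ?_
    rw [← hnorm] at h1
    have h3 : H (circleMap 0 (r n) θ) ≠ 0 := mul_ne_zero h2 (Complex.exp_ne_zero _)
    have h4 := (Real.log_lt_iff_lt_exp (norm_pos_iff.2 h3)).2 h1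
    linarith [Real.log_nonneg (le_max_right C 1)]

/-- Otherwise the zeros accumulate at `i` and the identity theorem applies. -/
theorem exists_pos_apply_I_mul_ne_zero (hF : Differentiable ℂ F) (h0 : ∃ z, F z ≠ 0) :
    ∃ y : ℝ, 0 < y ∧ F (Complex.I * y) ≠ 0 := by
  by_contra! hcon
  obtain ⟨z, hz⟩ := h0
  have han : AnalyticOnNhd ℂ F Set.univ := hF.differentiableOn.analyticOnNhd isOpen_univ
  have ht : Tendsto (fun t : ℝ => Complex.I * t) (𝓝[≠] 1) (𝓝[≠] Complex.I) := by
    refine tendsto_nhdsWithin_iff.2 ⟨?_, ?_⟩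
    · have : Continuous fun t : ℝ => Complex.I * t := by fun_prop
      simpa using (this.tendsto 1).mono_left nhdsWithin_le_nhds
    · filter_upwards [self_mem_nhdsWithin] with t ht h
      exact ht (by simpa using congrArg Complex.im (Set.mem_singleton_iff.1 h))
  have hev : ∀ᶠ t : ℝ in 𝓝[≠] 1, F (Complex.I * t) = 0 := by
    filter_upwards [nhdsWithin_le_nhds (lt_mem_nhds one_pos)] with t ht using hcon t ht
  exact hz (han.eqOn_zero_of_preconnected_of_frequently_eq_zero isPreconnected_univ trivial
    (ht.frequently hev.frequently) trivial)

theorem div_le_arctan_sub_arctan {u v : ℝ} (hu : 0 ≤ u) (huv : u < v) :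
    (v - u) / (1 + v ^ 2) ≤ Real.arctan v - Real.arctan u := by
  obtain ⟨c, hc, h⟩ := exists_hasDerivAt_eq_slope Real.arctan (fun x => 1 / (1 + x ^ 2)) huv
    Real.continuous_arctan.continuousOn (fun x _ => Real.hasDerivAt_arctan x)
  have h1 : 0 < v - u := sub_pos.2 huv
  rw [eq_div_iff h1.ne'] at h
  rw [← h, div_mul_eq_mul_div, one_mul]
  have : c ^ 2 ≤ v ^ 2 := pow_le_pow_left₀ (hu.trans hc.1.le) hc.2.le 2
  gcongr

/-- A nonzero entire function of exponential type, bounded on the real line, cannot be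
exponentially small on a whole interval of proportional length far out. -/
theorem exists_exp_neg_le_norm (hF : Differentiable ℂ F)
    (hb : ∀ z, ‖F z‖ ≤ C * Real.exp (σ * |z.im|)) (h0 : ∃ z, F z ≠ 0) {δ : ℝ} (hδ : 0 < δ) :
    ∃ A : ℝ, ∀ a b : ℝ, A ≤ a → a < b → a + δ * b ≤ b →
      ∃ x ∈ Set.Icc a b, Real.exp (-(δ * b)) ≤ ‖F (x : ℂ)‖ := by
  obtain ⟨y, hy, hFy⟩ := exists_pos_apply_I_mul_ne_zero hF h0
  obtain ⟨Λ, hΛ, hΛF⟩ := exists_lintegrable_log_majorant hF hb hy hFy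
  have hpi := Real.pi_pos
  -- The angles of real points beyond `a` shrink to the empty set, so the integrable majorant has
  -- small mass there.
  have htail : Tendsto (fun a : ℝ => ∫⁻ θ in Set.Ioc (Real.pi + 2 * Real.arctan (a / y))
      (2 * Real.pi), Λ θ ∂(volume.restrict (Set.Ioc 0 (2 * Real.pi)))) atTop (𝓝 0) := by
    refine tendsto_setLIntegral_zero hΛ ?_
    have h1 : Tendsto (fun a : ℝ => Real.arctan (a / y)) atTop (𝓝 (Real.pi / 2)) :=
      (Real.tendsto_arctan_atTop.mono_right nhdsWithin_le_nhds).comp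
        (tendsto_id.atTop_div_const hy)
    have h2 : Tendsto (fun a : ℝ => ENNReal.ofReal
        (2 * Real.pi - (Real.pi + 2 * Real.arctan (a / y)))) atTop (𝓝 0) := by
      have h3 := (tendsto_const_nhds (x := 2 * Real.pi)).sub
        ((tendsto_const_nhds (x := Real.pi)).add (h1.const_mul 2))
      rw [show 2 * Real.pi - (Real.pi + 2 * (Real.pi / 2)) = 0 by ring] at h3
      simpa using ENNReal.tendsto_ofReal h3
    refine tendsto_of_tendsto_of_tendsto_of_le_of_le tendsto_const_nhds h2
      (fun _ => zero_le) fun a => ?_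
    exact (Measure.restrict_apply_le _ _).trans_eq Real.volume_Ioc
  have hκ : (0 : ENNReal) < ENNReal.ofReal (δ ^ 2 * y) :=
    ENNReal.ofReal_pos.2 (by positivity)
  obtain ⟨A, hA⟩ := eventually_atTop.1 (htail.eventually_lt_const hκ)
  refine ⟨max A y, fun a b ha haltb hab => ?_⟩
  have hya : y ≤ a := (le_max_right _ _).trans ha
  have hb0 : 0 < b := hy.trans (hya.trans_lt haltb)
  by_contra! hcon
  have hlt := hA a ((le_max_left _ _).trans ha)
  refine absurd hlt (not_lt.2 ?_)
  have hsub : Set.Ioc (Real.pi + 2 * Real.arctan (a / y)) (Real.pi + 2 * Real.arctan (b / y)) ⊆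
      Set.Ioc (Real.pi + 2 * Real.arctan (a / y)) (2 * Real.pi) :=
    Set.Ioc_subset_Ioc_right (by linarith [Real.arctan_lt_pi_div_two (b / y)])
  have hsub' : Set.Ioc (Real.pi + 2 * Real.arctan (a / y)) (2 * Real.pi) ⊆
      Set.Ioc 0 (2 * Real.pi) :=
    Set.Ioc_subset_Ioc_left (by linarith [Real.neg_pi_div_two_lt_arctan (a / y)])
  rw [Measure.restrict_restrict measurableSet_Ioc, Set.inter_eq_left.2 hsub']
  refine le_trans ?_ (lintegral_mono_set hsub)
  have hge : ∀ θ ∈ Set.Ioc (Real.pi + 2 * Real.arctan (a / y))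
      (Real.pi + 2 * Real.arctan (b / y)), ENNReal.ofReal (δ * b) ≤ Λ θ := by
    intro θ hθ
    set s := Real.tan ((θ - Real.pi) / 2) with hs
    have h1 : -(Real.pi / 2) < (θ - Real.pi) / 2 := by
      linarith [Real.neg_pi_div_two_lt_arctan (a / y), hθ.1]
    have h2 : (θ - Real.pi) / 2 < Real.pi / 2 := by
      linarith [Real.arctan_lt_pi_div_two (b / y), hθ.2]
    have h3 : Real.arctan s = (θ - Real.pi) / 2 := Real.arctan_tan h1 h2
    have h4 : Real.pi + 2 * Real.arctan s = θ := by rw [h3]; ring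
    rw [← h4] at hθ ⊢
    have h5 : a / y < s := Real.arctan_strictMono.lt_iff_lt.1 (by linarith [hθ.1])
    have h6 : s ≤ b / y := Real.arctan_strictMono.le_iff_le.1 (by linarith [hθ.2])
    refine hΛF s _ (hcon (y * s) ⟨?_, ?_⟩)
    · rw [div_lt_iff₀ hy] at h5; linarith
    · rw [le_div_iff₀ hy] at h6; linarith
  refine le_trans ?_ (setLIntegral_mono' measurableSet_Ioc hge)
  rw [setLIntegral_const, Real.volume_Ioc, ← ENNReal.ofReal_mul (by positivity)]
  refine ENNReal.ofReal_le_ofReal ?_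
  have hat := div_le_arctan_sub_arctan (div_nonneg (hy.le.trans hya) hy.le)
    ((div_lt_div_iff_of_pos_right hy).2 haltb)
  -- The interval occupies an angle of at least `δy / b`, on which the majorant is at least `δb`.
  -- The product `δ²y` does not depend on the interval and contradicts the small tail.
  have hlow : δ * y / (2 * b) ≤ (b / y - a / y) / (1 + (b / y) ^ 2) := by
    have h1 : (b / y - a / y) / (1 + (b / y) ^ 2) = (b - a) * y / (y ^ 2 + b ^ 2) := by
      field_simp
    rw [h1, div_le_div_iff₀ (by positivity) (by positivity)]
    have h2 : y ^ 2 ≤ b ^ 2 := pow_le_pow_left₀ hy.le (hya.trans haltb.le) 2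
    have h3 : δ * b ≤ b - a := by linarith
    calc δ * y * (y ^ 2 + b ^ 2) ≤ δ * y * (b ^ 2 + b ^ 2) := by gcongr
      _ = (δ * b) * (y * (2 * b)) := by ring
      _ ≤ (b - a) * (y * (2 * b)) := by gcongr
      _ = (b - a) * y * (2 * b) := by ring
  have h7 : δ * y / (2 * b) ≤ Real.arctan (b / y) - Real.arctan (a / y) := hlow.trans hat
  calc δ ^ 2 * y = δ * b * (2 * (δ * y / (2 * b))) := by field_simp
    _ ≤ δ * b * (2 * (Real.arctan (b / y) - Real.arctan (a / y))) := by gcongr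
    _ = _ := by ring

end ExponentialType

/-! ### Injectivity of the sine transform -/

/-- An integrable function on the line whose Fourier transform vanishes is zero. -/
theorem ae_eq_zero_of_integral_mul_cexp_eq_zero {u : ℝ → ℝ} (hu : Integrable u)
    (h : ∀ ξ : ℝ, ∫ x, (u x : ℂ) * Complex.exp (ξ * x * Complex.I) = 0) : u =ᵐ[volume] 0 := by
  have hp : AEMeasurable (fun x => ENNReal.ofReal (u x)) volume :=
    hu.aestronglyMeasurable.aemeasurable.ennreal_ofReal
  have hm : AEMeasurable (fun x => ENNReal.ofReal (-u x)) volume :=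
    hu.neg.aestronglyMeasurable.aemeasurable.ennreal_ofReal
  have hpt : ∫⁻ x, ENNReal.ofReal (u x) ≠ ⊤ := hu.lintegral_lt_top.ne
  have hmt : ∫⁻ x, ENNReal.ofReal (-u x) ≠ ⊤ := hu.neg.lintegral_lt_top.ne
  have := isFiniteMeasure_withDensity hpt
  have := isFiniteMeasure_withDensity hmt
  have hint : ∀ v : ℝ → ℝ, Integrable v → ∀ ξ : ℝ,
      Integrable fun x => (max (v x) 0) • Complex.exp (ξ * x * Complex.I) := fun v hv ξ => by
    refine hv.pos_part.norm.mono' (hv.pos_part.aestronglyMeasurable.smul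
      (Continuous.aestronglyMeasurable (by fun_prop))) (Eventually.of_forall fun x => ?_)
    rw [norm_smul, ← Complex.ofReal_mul, Complex.norm_exp_ofReal_mul_I, mul_one]
  -- The positive and negative parts of `u` define finite measures with the same characteristic
  -- function.
  have heq : (volume.withDensity fun x => ENNReal.ofReal (u x)) =
      volume.withDensity fun x => ENNReal.ofReal (-u x) := by
    refine Measure.ext_of_charFun (funext fun ξ => ?_)
    rw [charFun_apply_real, charFun_apply_real,
      integral_withDensity_eq_integral_toReal_smul₀ hp
        (Eventually.of_forall fun _ => ENNReal.ofReal_lt_top),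
      integral_withDensity_eq_integral_toReal_smul₀ hm
        (Eventually.of_forall fun _ => ENNReal.ofReal_lt_top), ← sub_eq_zero]
    simp only [ENNReal.toReal_ofReal']
    refine (integral_sub (hint u hu ξ) (hint _ hu.neg ξ)).symm.trans ?_
    rw [← h ξ]
    congr 1
    ext x
    rw [← sub_smul, Complex.real_smul]
    congr 2
    rw [Pi.neg_apply]
    rcases le_total 0 (u x) with hx | hx
    · rw [max_eq_left hx, max_eq_right (by linarith), sub_zero]
    · rw [max_eq_right hx, max_eq_left (by linarith), zero_sub, neg_neg]
  filter_upwards [(withDensity_eq_iff hp hm hpt).1 heq] with x hx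
  rcases le_total 0 (u x) with h0 | h0
  · rw [ENNReal.ofReal_of_nonpos (p := -u x) (by linarith), ENNReal.ofReal_eq_zero] at hx
    exact le_antisymm hx h0
  · rw [ENNReal.ofReal_of_nonpos h0, eq_comm, ENNReal.ofReal_eq_zero] at hx
    exact le_antisymm h0 (neg_nonpos.1 hx)

/-- Injectivity of the finite sine transform. -/
theorem ae_eq_zero_of_sineDeriv_eq_zero {T : ℝ} {φ : ℝ → ℝ} {k : ℝ} (hk : k ≠ 0)
    (hφ : IntegrableOn φ (Set.Ioo 0 T)) (h : ∀ x, sineDeriv T φ k 0 x = 0) :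
    φ =ᵐ[volume.restrict (Set.Ioo 0 T)] 0 := by
  set ψ : ℝ → ℝ := (Set.Ioo 0 T).indicator φ with hψdef
  have hψ : Integrable ψ := (integrable_indicator_iff measurableSet_Ioo).2 hφ
  have hψe : ∀ ξ : ℝ, Integrable fun x : ℝ => (ψ x : ℂ) * Complex.exp (ξ * x * Complex.I) :=
    fun ξ => by
      refine hψ.norm.mono' (hψ.ofReal.aestronglyMeasurable.mul
        (Continuous.aestronglyMeasurable (by fun_prop))) (Eventually.of_forall fun x => ?_)
      rw [norm_mul, ← Complex.ofReal_mul, Complex.norm_exp_ofReal_mul_I, mul_one,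
        Complex.norm_real]
  -- The odd extension has Fourier transform `2i` times the sine transform.
  have hzero := ae_eq_zero_of_integral_mul_cexp_eq_zero (u := fun x => ψ x - ψ (-x))
    (hψ.sub hψ.comp_neg) (fun ξ => by
      have h1 : ∀ x : ℝ, ((ψ x - ψ (-x) : ℝ) : ℂ) * Complex.exp (ξ * x * Complex.I) =
          (ψ x : ℂ) * Complex.exp (ξ * x * Complex.I) -
          (fun x : ℝ => (ψ x : ℂ) * Complex.exp ((-ξ : ℝ) * x * Complex.I)) (-x) := fun x => by
        push_cast
        rw [neg_mul_neg]
        ring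
      simp only [h1]
      rw [integral_sub (hψe ξ) (hψe (-ξ)).comp_neg,
        integral_neg_eq_self (fun x : ℝ => (ψ x : ℂ) * Complex.exp ((-ξ : ℝ) * x * Complex.I)),
        ← integral_sub (hψe ξ) (hψe (-ξ))]
      have h2 : ∀ x : ℝ, (ψ x : ℂ) * Complex.exp (ξ * x * Complex.I) -
          (ψ x : ℂ) * Complex.exp ((-ξ : ℝ) * x * Complex.I) =
          2 * Complex.I * (((Set.Ioo 0 T).indicator (fun t => φ t * Real.sin (ξ * t)) x : ℝ) : ℂ)
          := fun x => by
        have h3 : (Set.Ioo 0 T).indicator (fun t => φ t * Real.sin (ξ * t)) x =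
            ψ x * Real.sin (ξ * x) := by
          rw [hψdef]
          exact Set.indicator_mul_left _ φ fun t => Real.sin (ξ * t)
        rw [h3]
        push_cast
        rw [Complex.sin]
        simp only [neg_mul]
        linear_combination ((ψ x : ℂ) * (Complex.exp (ξ * x * Complex.I) -
          Complex.exp (-(ξ * x * Complex.I)))) * Complex.I_sq
      simp only [h2]
      rw [integral_const_mul, integral_complex_ofReal, integral_indicator measurableSet_Ioo]
      have h4 := h (ξ / k)
      simp only [sineDeriv, pow_zero, one_mul, Nat.cast_zero, zero_mul, add_zero,
        mul_div_cancel₀ ξ hk] at h4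
      rw [h4]
      simp)
  filter_upwards [ae_restrict_of_ae hzero, ae_restrict_mem measurableSet_Ioo] with t ht htm
  have h1 : ψ (-t) = 0 := Set.indicator_of_notMem (fun h => by linarith [h.1, htm.1]) _
  have h2 : ψ t = φ t := Set.indicator_of_mem htm _
  simp only [h1, h2, sub_zero] at ht
  exact ht

/-! ### Measure of sublevel sets on the half line -/

theorem pow_div_factorial_le_exp_neg {a : ℝ} (ha : 0 ≤ a) {n : ℕ} (h : Real.exp 2 * a ≤ n) :
    a ^ n / n.factorial ≤ Real.exp (-n) := by
  have h1 : a ≤ n * Real.exp (-2) := by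
    rw [Real.exp_neg, ← div_eq_mul_inv, le_div_iff₀ (Real.exp_pos _)]
    linarith
  calc a ^ n / n.factorial ≤ (n * Real.exp (-2)) ^ n / n.factorial := by gcongr
    _ = (n : ℝ) ^ n / n.factorial * Real.exp (-2) ^ n := by rw [mul_pow]; ring
    _ ≤ Real.exp n * Real.exp (-2) ^ n := by
        gcongr
        exact Real.pow_div_factorial_le_exp _ n.cast_nonneg n
    _ = Real.exp (-n) := by
        rw [← Real.exp_nat_mul, ← Real.exp_add]
        congr 1
        ring

/-- Pigeonhole principle: a subset of `[0, N L)` of large outer measure has a large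
intersection with one of the `N` intervals `[j L, (j + 1) L)`. -/
theorem exists_lt_volume_inter_Ico {E : Set ℝ} {N : ℕ} {L m : ℝ} (hL : 0 < L)
    (hE : E ⊆ Set.Ico 0 (N * L)) (hvol : ENNReal.ofReal (N * m) < volume E) :
    ∃ j : ℕ, j < N ∧ ENNReal.ofReal m < volume (E ∩ Set.Ico (j * L) ((j + 1) * L)) := by
  by_contra! hcon
  refine absurd hvol (not_lt.2 ?_)
  have hsub : E ⊆ ⋃ j ∈ Finset.range N, E ∩ Set.Ico ((j : ℝ) * L) ((j + 1) * L) := by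
    intro x hx
    have hx0 := hE hx
    have hq : 0 ≤ x / L := div_nonneg hx0.1 hL.le
    simp only [Set.mem_iUnion]
    refine ⟨⌊x / L⌋₊, ?_, hx, ?_, ?_⟩
    · rw [Finset.mem_range, Nat.floor_lt hq, div_lt_iff₀ hL]
      exact hx0.2
    · rw [← le_div_iff₀ hL]; exact Nat.floor_le hq
    · rw [← div_lt_iff₀ hL]; exact Nat.lt_floor_add_one _
  refine (measure_mono hsub).trans ((measure_biUnion_finset_le _ _).trans ?_)
  refine (Finset.sum_le_sum fun j hj => hcon j (Finset.mem_range.1 hj)).trans_eq ?_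
  rw [Finset.sum_const, Finset.card_range, nsmul_eq_mul, ENNReal.ofReal_mul N.cast_nonneg,
    ENNReal.ofReal_natCast]

/-- Sublevel sets of a function of exponential type which is not exponentially small on
long intervals: at level `R ^ (-c R)`, their measure in `[0, R)` is at most `R⁻³`. -/
theorem eventually_volume_sublevel_le {S : ℕ → ℝ → ℝ}
    (hS : ∀ i x, HasDerivAt (S i) (S (i + 1) x) x) {C σ : ℝ} (hσ : 0 ≤ σ)
    (hbd : ∀ n x, |S n x| ≤ C * σ ^ n)
    (hgood : ∀ δ : ℝ, 0 < δ → ∃ A : ℝ, ∀ a b : ℝ, A ≤ a → a < b → a + δ * b ≤ b →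
      ∃ x ∈ Set.Icc a b, Real.exp (-(δ * b)) ≤ |S 0 x|) {c : ℝ} (hc : 0 < c) :
    ∀ᶠ R : ℝ in atTop,
      volume {r | r ∈ Set.Ico 0 R ∧ |S 0 r| ≤ Real.exp (-(c * (R * Real.log R)))} ≤
        ENNReal.ofReal (1 / R ^ 3) := by
  have hC : 0 ≤ C := by simpa using (abs_nonneg _).trans (hbd 0 0)
  -- With `n ≥ K L`, the summand `e²σ` yields `(σL)ⁿ / n! ≤ exp (-n)`, and the summand `2` yields
  -- `exp (-n) ≤ exp (-2L)`.
  set K : ℝ := Real.exp 2 * σ + 2 with hK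
  have hK2 : 2 ≤ K := by
    have : 0 ≤ Real.exp 2 * σ := mul_nonneg (Real.exp_nonneg _) hσ
    linarith
  -- As `n ≤ 2KL` and `NL = R`, the two bounds give `n ≤ R` and `7n ≤ cR / 4`.
  obtain ⟨N, hN⟩ := exists_nat_ge (max (2 * K) (56 * K / c))
  have hN1 : 2 * K ≤ N := (le_max_left _ _).trans hN
  have hN2 : 56 * K / c ≤ N := (le_max_right _ _).trans hN
  rw [div_le_iff₀ hc] at hN2
  have hN0 : (0 : ℝ) < N := by linarith
  obtain ⟨A, hA⟩ := hgood (1 / (2 * N)) (by positivity)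
  have hlog : ∀ᶠ R : ℝ in atTop, 4 / c ≤ Real.log R :=
    Real.tendsto_log_atTop.eventually_ge_atTop _
  have hexp : ∀ᶠ R : ℝ in atTop, C + 1 < Real.exp (R / N) :=
    (Real.tendsto_exp_atTop.comp (tendsto_id.atTop_div_const hN0)).eventually_gt_atTop _
  filter_upwards [eventually_ge_atTop (2 : ℝ), eventually_ge_atTop (N : ℝ),
    eventually_ge_atTop (2 * N * A), eventually_ge_atTop (4 / c), hlog, hexp]
    with R hR2 hRN hRA hRc hRlog hRexp
  rw [div_le_iff₀ hc] at hRc hRlog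
  have hR0 : 0 < R := by linarith
  by_contra! hvol
  set η := Real.exp (-(c * (R * Real.log R))) with hη
  set L := R / N with hL
  have hL1 : 1 ≤ L := (one_le_div hN0).2 hRN
  have hL0 : 0 < L := by linarith
  have hNL : N * L = R := by rw [hL]; field_simp
  have hLR : L ≤ R := by
    rw [← hNL]
    nlinarith
  obtain ⟨j, hjN, hj⟩ := exists_lt_volume_inter_Ico (m := 1 / R ^ 4) (N := N) hL0
    (by rw [hNL]; exact fun r hr => hr.1) (lt_of_le_of_lt (ENNReal.ofReal_le_ofReal (by
      rw [mul_one_div, div_le_div_iff₀ (by positivity) (by positivity)]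
      nlinarith [pow_pos hR0 3])) hvol)
  set n := ⌈K * L⌉₊ with hn
  have h2L : 2 * L ≤ n ∧ Real.exp 2 * (σ * L) ≤ n := by
    have h1 : K * L ≤ n := Nat.le_ceil _
    have h2 : 0 ≤ Real.exp 2 * (σ * L) := by positivity
    rw [hK] at h1
    constructor <;> linarith
  have hnK : K * L ≤ n := Nat.le_ceil _
  have hnK' : n ≤ 2 * K * L := by
    have h1 : (n : ℝ) < K * L + 1 := Nat.ceil_lt_add_one (by positivity)
    nlinarith
  have hn0 : 0 < n := Nat.ceil_pos.2 (by positivity)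
  have hnR : (n : ℝ) ≤ R := by
    rw [← hNL]
    nlinarith
  have hnc : 7 * (n : ℝ) ≤ c / 4 * R := by
    rw [← hNL]
    nlinarith
  -- Separation `R⁻⁶` is affordable: `n` points use up measure `2n R⁻⁶ ≤ R⁻⁴`.
  obtain ⟨s, hscard, hsE, hsep⟩ := exists_separated_finset (d := 1 / R ^ 6) n
    (lt_of_le_of_lt (ENNReal.ofReal_le_ofReal (by
      rw [mul_one_div, div_le_div_iff₀ (by positivity) (by positivity)]
      have h1 : 0 < R ^ 4 := by positivity
      have h2 : 2 * (n : ℝ) ≤ R ^ 2 := by nlinarith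
      calc 2 * (n : ℝ) * R ^ 4 ≤ R ^ 2 * R ^ 4 := by gcongr
        _ = 1 * R ^ 6 := by ring)) hj) (by positivity)
  have hj1 : ((j : ℝ) + 1) ≤ N := by exact_mod_cast hjN
  have hb : ((j : ℝ) + 1) * L ≤ R := by
    rw [← hNL]
    gcongr
  have hδb : 1 / (2 * N) * (((j : ℝ) + 1) * L) ≤ L / 2 := by
    rw [one_div_mul_eq_div, div_le_div_iff₀ (by positivity) two_pos]
    nlinarith
  -- Using the right half of the interval keeps its left end at least `L / 2`, hence beyond `A`,
  -- even when `j = 0`.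
  obtain ⟨x, hx, hxlow⟩ := hA ((j + 1 / 2) * L) ((j + 1) * L)
    (by
      have h1 : A ≤ L / 2 := by
        rw [hL, div_div, le_div_iff₀ (by positivity)]
        linarith
      have h2 : (0 : ℝ) ≤ j * L := by positivity
      linarith) (by linarith) (by linarith)
  have hup := abs_le_of_small_at_separated_points hS (D := C * σ ^ n) (η := η) (L := L)
    (d := 1 / R ^ 6) (hbd n) (Real.exp_nonneg _) (by positivity)
    (((div_le_one (by positivity)).2 (one_le_pow₀ (by linarith))).trans hL1) hscard hn0
    (fun z hz => (hsE hz).1.2) hsep (x := x) (fun z hz => by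
      have h1 := (hsE hz).2
      rw [abs_le]
      constructor <;> linarith [hx.1, hx.2, h1.1, h1.2])
  have hfirst : C * σ ^ n * L ^ n / n.factorial ≤ C * Real.exp (-(2 * L)) := by
    rw [mul_assoc, ← mul_pow, mul_div_assoc]
    refine mul_le_mul_of_nonneg_left ?_ hC
    refine (pow_div_factorial_le_exp_neg (mul_nonneg hσ hL0.le) h2L.2).trans
      (Real.exp_le_exp.2 (neg_le_neg h2L.1))
  have hlogR : 0 < Real.log R := Real.log_pos (by linarith)
  have hpow : (L / (1 / R ^ 6)) ^ n ≤ Real.exp (c / 4 * R * Real.log R) := by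
    have h1 : L / (1 / R ^ 6) ≤ R ^ 7 := by
      rw [div_div_eq_mul_div, div_one]
      calc L * R ^ 6 ≤ R * R ^ 6 := by gcongr
        _ = R ^ 7 := by ring
    calc (L / (1 / R ^ 6)) ^ n ≤ (R ^ 7) ^ n := by gcongr
      _ = Real.exp (7 * n * Real.log R) := by
        rw [← pow_mul, mul_comm _ (Real.log R), Real.exp_mul, Real.exp_log hR0]
        exact_mod_cast rfl
      _ ≤ _ := Real.exp_le_exp.2 (mul_le_mul_of_nonneg_right hnc hlogR.le)
  have hnexp : (n : ℝ) ≤ Real.exp (c / 4 * R * Real.log R) := by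
    refine hnR.trans ?_
    rw [← Real.log_le_iff_le_exp hR0]
    exact le_mul_of_one_le_left hlogR.le (by linarith)
  -- The factor `n` and the power each cost a quarter of the exponent `c R log R`; the remaining
  -- half exceeds `2L`.
  have hsecond : n * (η * (L / (1 / R ^ 6)) ^ n) ≤ Real.exp (-(2 * L)) := by
    calc n * (η * (L / (1 / R ^ 6)) ^ n) ≤ Real.exp (c / 4 * R * Real.log R) *
          (η * Real.exp (c / 4 * R * Real.log R)) := by gcongr
      _ = Real.exp (-(c / 2 * R * Real.log R)) := by
        rw [hη, ← Real.exp_add, ← Real.exp_add]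
        congr 1
        ring
      _ ≤ Real.exp (-(2 * L)) := by
        refine Real.exp_le_exp.2 (neg_le_neg ?_)
        have h1 : R * 4 ≤ R * (Real.log R * c) := mul_le_mul_of_nonneg_left hRlog hR0.le
        linarith
  have hlow : Real.exp (-L) ≤ |S 0 x| :=
    (Real.exp_le_exp.2 (by linarith)).trans hxlow
  have hfin : Real.exp (-L) ≤ (C + 1) * Real.exp (-(2 * L)) := by linarith
  have h2 : Real.exp (-L) = Real.exp L * Real.exp (-(2 * L)) := by
    rw [← Real.exp_add]
    congr 1
    ring
  rw [h2] at hfin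
  exact absurd (le_of_mul_le_mul_right hfin (Real.exp_pos _)) (not_le.2 hRexp)

/-! ### Countability of zeros and radial sets in the plane -/

theorem countable_zeros_of_differentiable {F : ℂ → ℂ} (hF : Differentiable ℂ F)
    (h0 : ∃ z, F z ≠ 0) : {z | F z = 0}.Countable := by
  obtain ⟨z₀, hz₀⟩ := h0
  have han : AnalyticOnNhd ℂ F Set.univ := hF.differentiableOn.analyticOnNhd isOpen_univ
  obtain ⟨t, -, htc, hcov⟩ := TopologicalSpace.countable_cover_nhdsWithin
    (f := fun z => {z}) (s := {z | F z = 0}) (fun z _ => by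
      rcases (han z trivial).eventually_eq_zero_or_eventually_ne_zero with h | h
      · exact absurd (han.eqOn_zero_of_preconnected_of_eventuallyEq_zero
          isPreconnected_univ trivial h (Set.mem_univ z₀)) hz₀
      · rw [eventually_nhdsWithin_iff] at h
        rw [mem_nhdsWithin_iff_eventually]
        filter_upwards [h] with w hw hw0
        by_contra hne
        exact hw hne hw0)
  exact htc.mono (by simpa using hcov)

/-- The rotationally symmetric subset of the plane with radial part `E`. -/
theorem volume_norm_mem_le {E : Set ℝ} (hE : MeasurableSet E) {R : ℝ}
    (hER : E ⊆ Set.Ico 0 R) :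
    volume {α : EuclideanSpace ℝ (Fin 2) | ‖α‖ ∈ E} ≤ ENNReal.ofReal
      (2 * volume.real (Metric.ball (0 : EuclideanSpace ℝ (Fin 2)) 1) * R) * volume E := by
  set P : Set (EuclideanSpace ℝ (Fin 2)) := {α | ‖α‖ ∈ E} with hP
  set v := volume.real (Metric.ball (0 : EuclideanSpace ℝ (Fin 2)) 1) with hv
  rcases lt_or_ge R 0 with hR | hR
  · have hEe : E = ∅ := Set.eq_empty_of_forall_notMem fun x hx => by
      linarith [(hER hx).1, (hER hx).2]
    simp [hP, hEe]
  have hPm : MeasurableSet P := measurable_norm hE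
  have hPfin : volume P ≠ ⊤ := ne_top_of_le_ne_top
    (Metric.isBounded_ball (x := (0 : EuclideanSpace ℝ (Fin 2))) (r := R)).measure_lt_top.ne
    (measure_mono fun α hα => mem_ball_zero_iff.2 (hER hα).2)
  have hEfin : volume E ≠ ⊤ := ne_top_of_le_ne_top
    (by rw [Real.volume_Ico]; exact ENNReal.ofReal_ne_top) (measure_mono hER)
  have h1 := integral_fun_norm_addHaar (volume : Measure (EuclideanSpace ℝ (Fin 2)))
    (E.indicator (1 : ℝ → ℝ))
  have h2 : ∫ α : EuclideanSpace ℝ (Fin 2), E.indicator (1 : ℝ → ℝ) ‖α‖ = volume.real P :=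
    integral_indicator_one hPm
  have hEi : Integrable (E.indicator (1 : ℝ → ℝ)) :=
    (integrable_indicator_iff hE).2 (integrableOn_const hEfin)
  have h3 : ∫ y in Set.Ioi (0 : ℝ), y * E.indicator (1 : ℝ → ℝ) y ≤ R * volume.real E := by
    rw [← integral_indicator_one hE, ← integral_const_mul]
    refine (integral_mono_of_nonneg ?_ (hEi.const_mul R).integrableOn ?_).trans
      (setIntegral_le_integral (hEi.const_mul R) ?_)
    · filter_upwards [ae_restrict_mem measurableSet_Ioi] with y hy
      exact mul_nonneg (Set.mem_Ioi.1 hy).le (Set.indicator_nonneg (fun _ _ => zero_le_one) _)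
    · refine Eventually.of_forall fun y => ?_
      by_cases hy : y ∈ E
      · simpa [hy] using (hER hy).2.le
      · simp [hy]
    · exact Eventually.of_forall fun y =>
        mul_nonneg hR (Set.indicator_nonneg (fun _ _ => zero_le_one) _)
  rw [h2, finrank_euclideanSpace_fin, Nat.add_one_sub_one] at h1
  simp only [pow_one, smul_eq_mul, nsmul_eq_mul, Nat.cast_ofNat] at h1
  have hv0 : 0 ≤ v := measureReal_nonneg
  rw [← ofReal_measureReal hPfin, ← ofReal_measureReal hEfin,
    ← ENNReal.ofReal_mul (by positivity), h1]
  refine ENNReal.ofReal_le_ofReal ?_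
  calc 2 * (v * ∫ y in Set.Ioi (0 : ℝ), y * E.indicator (1 : ℝ → ℝ) y)
      ≤ 2 * (v * (R * volume.real E)) := by gcongr
    _ = _ := by ring

/-! ### Asymptotics of the radius and conclusion -/

theorem tendsto_log_inv_nhdsGT_zero :
    Tendsto (fun ε : ℝ => Real.log ε⁻¹) (𝓝[>] 0) atTop :=
  Real.tendsto_log_atTop.comp tendsto_inv_nhdsGT_zero

theorem tendsto_truncR {T q : ℝ} (hT : 0 < T) (hq : 0 < q) :
    Tendsto (truncR T q) (𝓝[>] 0) atTop := by
  have h1 : Tendsto (fun ℓ : ℝ => ℓ / Real.log ℓ) atTop atTop := by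
    refine ((Real.tendsto_exp_div_pow_atTop 1).comp Real.tendsto_log_atTop).congr' ?_
    filter_upwards [eventually_gt_atTop 0] with ℓ hℓ
    simp [Real.exp_log hℓ]
  exact (h1.comp tendsto_log_inv_nhdsGT_zero).const_mul_atTop (by positivity)

/-- Write `ℓ = log ε⁻¹` and `R = κ ℓ / log ℓ`. Eventually `R ≤ ℓ`, so `R log R ≤ R log ℓ = κℓ`, and
`9eTκ = q`. -/
theorem eventually_rpow_le_exp_truncR {T q : ℝ} (hT : 0 < T) (hq : 0 < q) :
    ∀ᶠ ε in 𝓝[>] (0 : ℝ), ε ^ q ≤ Real.exp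
      (-(9 * Real.exp 1 * T * (truncR T q ε * Real.log (truncR T q ε)))) := by
  set κ := q / (9 * Real.exp 1 * T) with hκ
  have hκ0 : 0 < κ := by positivity
  filter_upwards [self_mem_nhdsWithin,
    (tendsto_truncR hT hq).eventually_gt_atTop 0,
    tendsto_log_inv_nhdsGT_zero.eventually_gt_atTop 0,
    (Real.tendsto_log_atTop.comp tendsto_log_inv_nhdsGT_zero).eventually_ge_atTop (max κ 1)]
    with ε hε hR hℓ hll
  have hε0 : 0 < ε := hε
  simp only [Function.comp_apply] at hll
  set ℓ := Real.log ε⁻¹ with hℓdef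
  have hll1 : 1 ≤ Real.log ℓ := (le_max_right _ _).trans hll
  have hllκ : κ ≤ Real.log ℓ := (le_max_left _ _).trans hll
  have hReq : truncR T q ε = κ * (ℓ / Real.log ℓ) := rfl
  have hRℓ : truncR T q ε ≤ ℓ := by
    rw [hReq, mul_div_assoc', div_le_iff₀ (by linarith), mul_comm]
    exact mul_le_mul_of_nonneg_left hllκ hℓ.le
  have hRlog : truncR T q ε * Real.log (truncR T q ε) ≤ κ * ℓ := by
    calc truncR T q ε * Real.log (truncR T q ε) ≤ truncR T q ε * Real.log ℓ :=
          mul_le_mul_of_nonneg_left (Real.log_le_log hR hRℓ) hR.le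
      _ = κ * ℓ := by
        rw [hReq]
        have : Real.log ℓ ≠ 0 := by linarith
        field_simp
  have hεq : ε ^ q = Real.exp (-(q * ℓ)) := by
    rw [Real.rpow_def_of_pos hε0, hℓdef, Real.log_inv]
    congr 1
    ring
  rw [hεq]
  refine Real.exp_le_exp.2 (neg_le_neg ?_)
  calc 9 * Real.exp 1 * T * (truncR T q ε * Real.log (truncR T q ε)) ≤
        9 * Real.exp 1 * T * (κ * ℓ) := by gcongr
    _ = q * ℓ := by rw [hκ]; field_simp

theorem lemma2 (T τ q : ℝ) (hT : 0 < T) (hτ : 0 < τ) (hq : 0 < q)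
    (φ₀ : ℝ → ℝ)
    (hφ₀ : MeasureTheory.IntegrableOn φ₀ (Set.Ioo 0 T) MeasureTheory.volume)
    (hne : ¬ φ₀ =ᵐ[MeasureTheory.volume.restrict (Set.Ioo 0 T)] 0) :
    (∀ᵐ α : EuclideanSpace ℝ (Fin 2) ∂MeasureTheory.volume, sineD T φ₀ τ α ≠ 0) ∧
    (∀ᶠ ε : ℝ in nhdsWithin 0 (Set.Ioi 0),
      MeasureTheory.volume (smallSet T φ₀ τ q ε) < ENNReal.ofReal (truncR T q ε)⁻¹) := by
  have hk : 0 < Real.sqrt τ := Real.sqrt_pos.2 hτ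
  set k := Real.sqrt τ with hkdef
  have hF := differentiable_sineEntire hk.le hφ₀
  have hF0 : ∃ z, sineEntire T φ₀ k z ≠ 0 := by
    by_contra! hcon
    refine hne (ae_eq_zero_of_sineDeriv_eq_zero hk.ne' hφ₀ fun x => ?_)
    have := hcon x
    rwa [sineEntire_ofReal, Complex.ofReal_eq_zero] at this
  refine ⟨?_, ?_⟩
  · have hZ : {x : ℝ | sineDeriv T φ₀ k 0 x = 0}.Countable := by
      refine ((countable_zeros_of_differentiable hF hF0).preimage
        Complex.ofReal_injective).mono fun x hx => ?_
      rw [Set.mem_preimage, Set.mem_ofPred_eq, sineEntire_ofReal, hx, Complex.ofReal_zero]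
    have hnull := (measure_biUnion_null_iff hZ
      (s := fun r => Metric.sphere (0 : EuclideanSpace ℝ (Fin 2)) r)).2
      fun r _ => Measure.addHaar_sphere volume _ r
    filter_upwards [measure_eq_zero_iff_ae_notMem.1 hnull] with α hα h
    refine hα (Set.mem_biUnion (x := ‖α‖) ?_ (mem_sphere_zero_iff_norm.2 rfl))
    rwa [sineD_eq_sineDeriv] at h
  · have hS := hasDerivAt_sineDeriv hk.le hφ₀
    have hsub := eventually_volume_sublevel_le hS (mul_nonneg hk.le hT.le)
      (abs_sineDeriv_le hk.le hφ₀) (fun δ hδ => by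
        obtain ⟨A, hA⟩ := exists_exp_neg_le_norm hF (norm_sineEntire_le hk.le hφ₀) hF0 hδ
        refine ⟨A, fun a b h1 h2 h3 => ?_⟩
        obtain ⟨x, hx, h⟩ := hA a b h1 h2 h3
        refine ⟨x, hx, ?_⟩
        rwa [sineEntire_ofReal, Complex.norm_real] at h)
      (c := 9 * Real.exp 1 * T) (by positivity)
    have hR := tendsto_truncR hT hq
    set v := volume.real (Metric.ball (0 : EuclideanSpace ℝ (Fin 2)) 1) with hv
    -- The planar measure is at most `2v R⁻²`, which is below `R⁻¹` exactly when `R > 2v`.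
    filter_upwards [hR.eventually hsub, hR.eventually_gt_atTop (2 * v),
      hR.eventually_gt_atTop 0, eventually_rpow_le_exp_truncR hT hq] with ε h1 h2 hR0 h3
    set R := truncR T q ε with hRdef
    set E : Set ℝ := {r | r ∈ Set.Ico 0 R ∧ |sineDeriv T φ₀ k 0 r| ≤ ε ^ q} with hE
    have hg : Continuous (sineDeriv T φ₀ k 0) :=
      continuous_iff_continuousAt.2 fun x => (hS 0 x).continuousAt
    have hEm : MeasurableSet E :=
      measurableSet_Ico.inter (measurableSet_le hg.measurable.abs measurable_const)
    have hset : smallSet T φ₀ τ q ε = {α | ‖α‖ ∈ E} := by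
      ext α
      simp [smallSet, hE, sineD_eq_sineDeriv, ← hRdef, hkdef]
    have hv0 : 0 ≤ v := measureReal_nonneg
    rw [hset]
    calc volume {α : EuclideanSpace ℝ (Fin 2) | ‖α‖ ∈ E}
        ≤ ENNReal.ofReal (2 * v * R) * volume E := volume_norm_mem_le hEm fun r hr => hr.1
      _ ≤ ENNReal.ofReal (2 * v * R) * ENNReal.ofReal (1 / R ^ 3) := by
        gcongr
        refine (measure_mono ?_).trans h1
        exact fun r hr => ⟨hr.1, hr.2.trans h3⟩
      _ = ENNReal.ofReal (2 * v * R * (1 / R ^ 3)) :=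
        (ENNReal.ofReal_mul (by positivity)).symm
      _ < ENNReal.ofReal R⁻¹ := by
        refine (ENNReal.ofReal_lt_ofReal_iff (by positivity)).2 ?_
        rw [mul_one_div, ← one_div, div_lt_div_iff₀ (by positivity) hR0]
        nlinarith [pow_pos hR0 2]
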